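/- Conventions. Let $q$ be a prime power and let $r\ge v\ge 1$, $\delta\ge 2$, $\tau\ge 1$ be integers. An $[n,k,d]_q$ linear code $\mathcal C$ is a $k$-dimensional subspace of $\mathbb F_q^n$ with minimum Hamming distance $d$. It has all symbol $(r,\delta)$-locality if every coordinate $j$ lies in a set $S_j\subseteq[n]$ with $|S_j|\le r+\delta-1$ such that the punctured code $\mathcal C|_{S_j}$ has minimum distance at least $\delta$. Such a code is optimal if $d=n-k+1-(\lceil k/r\rceil-1)(\delta-1)$. A $t$-$(n_1,b,1)$-packing is a family $\mathcal S$ of $b$-subsets (blocks) of an $n_1$-set such that every $t$-subset lies in at most one block; if every $t$-subset lies in exactly one block it is a $(t,b,n_1)$-Steiner system. For integers $w,u,v,d$ put $t=\lfloor (d-1)/\delta\rfloor$ and $$B(q,r,\delta,w,u,v,d)=\begin{cases}\frac{(t-1)(r+\delta-1)}{2r(q-1)}\,q^{\frac{2(w-u)r-2v}{t-1}}, & t\text{ odd},\\[2pt] \frac{t(r+\delta-1)}{2r(q-1)}\,q^{\frac{2(w-u)r-2v}{t}}, & t\text{ even}.\end{cases}$$ Let $n_1=q-r+v$. (1) Packings.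 Let $\mathcal S\neq\emptyset$ be the block set of a $(\tau+1)$-$(n_1,r+\delta-1,1)$-packing and let $r-v\le\delta^2/\tau$. Then there is an optimal $[n,k,d]_q$ linear code with all symbol $(r,\delta)$-locality, where $n=|\mathcal S|(r+\delta-1)$, $k=(|\mathcal S|-1)r+v$ and $d=r-v+\delta$. Moreover $n\le K q^{\tau+1}$ with $K$ depending only on $r,\delta,\tau$; and for each $c_0>0$ there is $c>0$, depending only on $r,\delta,\tau,c_0$, such that $|\mathcal S|\ge c_0n_1^{\tau+1}$ implies $n\ge c\,q^{\tau+1}$. (2) Let in addition $r-v=\delta+1$ and $\tau=\delta-1$ (so $d=2\delta+1$), $w=|\mathcal S|$, $w-1\ge 2(r-v+1)$ and $|\mathcal S|\ge c_0n_1^{\delta}$ with $c_0>0$. Then the code in (1) exists, and its length is asymptotically optimal with respect to the bound $B$: there are constants $c_1,c_2,K>0$ depending only on $r,\delta,c_0$ such that $c_1q^\delta\le n\le c_2q^\delta$ and such that, whenever $\mathcal C'$ is an optimal $[n',k',2\delta+1]_q$ linear code with all symbol $(r,\delta)$-locality, $n'=w'(r+\delta-1)$, $k'=u'r+v'$, $0\le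 v'<r$, and $v'=0$ or $u'\ge 2(r+1-v')$, one has $n'\le B(q,r,\delta,w',u',v',2\delta+1)\le K n$. (3) Steiner systems. Let $\tau+1\le r+\delta-1$, $r-v\le\delta^2/\tau$, and suppose that there is a $(\tau+1,r+\delta-1,n_1)$-Steiner system with at least one block. Then there is an optimal $[n,k,d]_q$ linear code with all symbol $(r,\delta)$-locality, where $$n=\frac{\binom{n_1}{\tau+1}(r+\delta-1)}{\binom{r+\delta-1}{\tau+1}},\qquad k=\left(\frac{\binom{n_1}{\tau+1}}{\binom{r+\delta-1}{\tau+1}}-1\right)r+v,\qquad d=r-v+\delta.$$ (4) Let $r-v=\delta+1$ and $\tau=\delta-1$ in (3), and let the number $w$ of blocks of the $(\delta,r+\delta-1,q-\delta-1)$-Steiner system satisfy $w-1\ge 2(r-v+1)$. Then the code in (3) exists, has $d=2\delta+1$, and its length is asymptotically optimal with respect to $B$ in the sense of (2), with constants $c_1,c_2,K>0$ depending only on $r,\delta$; in particular $n=\Theta(q^\delta)$. -/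

import Mathlib

universe uF uX

namespace LRC

section Codes

variable {F : Type uF} [Field F] [DecidableEq F]

/-- Every nonzero word of the linear code `C` has Hamming weight at least `d`, that is, the minimum
Hamming distance of `C` is at least `d` (vacuous for the zero code). -/
def MinDistAtLeast {ι : Type} [Fintype ι] (C : Submodule F (ι → F)) (d : ℕ) : Prop :=
  ∀ c ∈ C, c ≠ 0 → d ≤ hammingNorm c

/-- The minimum Hamming distance of the linear code `C` is exactly `d`. -/
def HasMinDist {ι : Type} [Fintype ι] (C : Submodule F (ι → F)) (d : ℕ) : Prop :=
  IsLeast {m : ℕ | ∃ c ∈ C, c ≠ 0 ∧ hammingNorm c = m} d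

/-- The punctured code `C|_R`, obtained by deleting all code symbols outside `R`. -/
def puncture {n : ℕ} (C : Submodule F (Fin n → F)) (R : Finset (Fin n)) :
    Submodule F (R → F) :=
  C.map (LinearMap.funLeft F F (fun i : R => (i : Fin n)))

/-- `R` is an `(r, δ)`-repair set of the code symbol `j`. -/
def IsRepairSet {n : ℕ} (C : Submodule F (Fin n → F)) (r δ : ℕ) (j : Fin n)
    (R : Finset (Fin n)) : Prop :=
  j ∈ R ∧ R.card ≤ r + δ - 1 ∧ MinDistAtLeast (puncture C R) δ

/-- All symbol `(r, δ)`-locality. -/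
def HasAllSymbolLocality {n : ℕ} (C : Submodule F (Fin n → F)) (r δ : ℕ) : Prop :=
  ∀ j : Fin n, ∃ R : Finset (Fin n), IsRepairSet C r δ j R

/-- `C` is an optimal `[n, k, d]` linear code with all symbol `(r, δ)`-locality: its minimum
distance attains the Singleton-type bound `d ≤ n - k + 1 - (⌈k / r⌉ - 1) (δ - 1)` with equality. -/
structure IsOptimalLRC {n : ℕ} (C : Submodule F (Fin n → F)) (k d r δ : ℕ) : Prop where
  dim : Module.finrank F C = k
  minDist : HasMinDist C d
  locality : HasAllSymbolLocality C r δ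
  optimal : (d : ℤ) = (n : ℤ) - k + 1 - (⌈(k : ℚ) / (r : ℚ)⌉ - 1) * ((δ : ℤ) - 1)

end Codes

/-- The upper bound on the length `n = w (r + δ - 1)` of an optimal `[n, u r + v, d]_q` linear code
with all symbol `(r, δ)`-locality, where `t = ⌊(d - 1) / δ⌋`. -/
noncomputable def lengthBound (q r δ w u v d : ℕ) : ℝ :=
  if Odd ((d - 1) / δ) then
    ((((d - 1) / δ : ℕ) : ℝ) - 1) * ((r : ℝ) + δ - 1) / (2 * r * ((q : ℝ) - 1)) *
      (q : ℝ) ^ ((2 * ((w : ℝ) - u) * r - 2 * v) / ((((d - 1) / δ : ℕ) : ℝ) - 1))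
  else
    (((d - 1) / δ : ℕ) : ℝ) * ((r : ℝ) + δ - 1) / (2 * r * ((q : ℝ) - 1)) *
      (q : ℝ) ^ ((2 * ((w : ℝ) - u) * r - 2 * v) / (((d - 1) / δ : ℕ) : ℝ))

/-- The length `n` is optimal up to the factor `K` with respect to the upper bound `lengthBound`,
for the field `F` and the parameters `r, δ, d`: every optimal code with all symbol
`(r, δ)`-locality and minimum distance `d` over `F`, of length `w (r + δ - 1)` and dimension
`u r + v` with `0 ≤ v < r`, and `r ∣ k` or `u ≥ 2 (r + 1 - v)`, obeys the bound, and the bound is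
at most `K n`. For a code of length `n` that itself belongs to this class, this says that the bound
is valid and that the code attains it up to the factor `K`. -/
def LengthOptimalUpTo (F : Type uF) [Field F] [Fintype F] [DecidableEq F]
    (r δ d n : ℕ) (K : ℝ) : Prop :=
  ∀ w u v : ℕ, v < r → (v = 0 ∨ 2 * (r + 1 - v) ≤ u) →
    ∀ C : Submodule F (Fin (w * (r + δ - 1)) → F), IsOptimalLRC C (u * r + v) d r δ →
      ((w * (r + δ - 1) : ℕ) : ℝ) ≤ lengthBound (Fintype.card F) r δ w u v d ∧
      lengthBound (Fintype.card F) r δ w u v d ≤ K * n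

/-- `S` is the set of blocks of a `t-(n₁, b, 1)`-packing with point set `X`. -/
structure IsPacking {X : Type uX} [Fintype X] (t n₁ b : ℕ) (S : Finset (Finset X)) : Prop where
  card_points : Fintype.card X = n₁
  card_block : ∀ B ∈ S, B.card = b
  at_most_one : ∀ T : Finset X, T.card = t → ∀ B ∈ S, ∀ B' ∈ S, T ⊆ B → T ⊆ B' → B = B'

/-- `S` is the set of blocks of a `(t, b, n₁)`-Steiner system with point set `X`. -/
structure IsSteinerSystem {X : Type uX} [Fintype X] (t b n₁ : ℕ) (S : Finset (Finset X)) :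
    Prop where
  card_points : Fintype.card X = n₁
  card_block : ∀ B ∈ S, B.card = b
  exactly_one : ∀ T : Finset X, T.card = t → ∃! B : Finset X, B ∈ S ∧ T ⊆ B

end LRC

namespace LRC

/-! ### Vandermonde systems. -/

section Vandermonde

variable {F : Type uF} [Field F] {ι : Type*}

/-! Existence. Inject the points of the packing into `F` and index coordinates by incident pairs
(block, point). Impose the power sums of degree below `δ - 1` on each block, and the next `r - v`
power sums globally. By Vandermonde these checks are independent, which gives the dimension, and
every nonzero local word has weight at least `δ`. A codeword of weight below `r - v + δ` must have
zero sum over all coordinates sharing a field element, so each support coordinate is matched by one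
in another block. Each block that it meets then has at least `δ` support points, all covered by
intersections of size at most `τ` with the other such blocks; counting contradicts `(r - v) * τ ≤ δ
^ 2` (`le_hammingNorm_of_mem_blockCode`).

Length bound. For `d = 2 * δ + 1` and `r = v + δ + 1`, optimality forces `w = u + 1` and `v' = v`,
and the bound reduces to `w * r * (q - 1) ≤ q ^ (δ + 1)`. Greedily chosen repair sets `R i` nearly
partition the coordinates (`exists_repair_chain`), so their private parts are large on average. Each
`δ`-subset of a private part supports a word of weight `δ` that looks locally like a codeword.
Nonzero scalar multiples of such words differ pairwise by weight at most `2 * δ < d`, so they lie in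
distinct cosets of `C` inside the space of locally consistent words. A packing of order `n₁ ^ δ`,
and in particular a Steiner system, reaches this size up to a constant. -/

theorem eq_zero_of_sum_mul_pow_eq_zero {s : Finset ι} {p : ι → F} (hp : Set.InjOn p s)
    {c : ι → F} (h : ∀ j < s.card, ∑ i ∈ s, c i * p i ^ j = 0) : ∀ i ∈ s, c i = 0 := by
  have e := s.equivFin.symm
  have h0 : (fun a => c (e a)) = 0 := by
    refine Matrix.eq_zero_of_forall_pow_sum_mul_pow_eq_zero (f := fun a => p (e a)) ?_ ?_
    · intro a b hab
      exact e.injective (Subtype.ext (hp (e a).2 (e b).2 hab))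
    · intro j
      rw [← h j j.2, ← Finset.sum_coe_sort s]
      exact Fintype.sum_equiv e _ _ fun _ => rfl
  intro i hi
  simpa using congrFun h0 (e.symm ⟨i, hi⟩)

/-- Invertibility of the Vandermonde matrix again, now as solvability. It yields both the
independence of the checks and a word of minimum weight. -/
theorem exists_sum_mul_pow_eq [DecidableEq ι] {s : Finset ι} {p : ι → F} (hp : Set.InjOn p s)
    (t : ℕ → F) :
    ∃ c : ι → F, (∀ i ∉ s, c i = 0) ∧ ∀ j < s.card, ∑ i ∈ s, c i * p i ^ j = t j := by
  have e := s.equivFin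
  let M := Matrix.vandermonde fun a => p (e.symm a)
  have hM : IsUnit M.det := by
    rw [isUnit_iff_ne_zero, Matrix.det_vandermonde_ne_zero_iff]
    intro a b hab
    exact e.symm.injective (Subtype.ext (hp (e.symm a).2 (e.symm b).2 hab))
  let g := Matrix.vecMul (fun j : Fin s.card => t j) M⁻¹
  have hg : Matrix.vecMul g M = fun j : Fin s.card => t j := by
    simp only [g, Matrix.vecMul_vecMul, Matrix.nonsing_inv_mul M hM, Matrix.vecMul_one]
  refine ⟨fun i => if hi : i ∈ s then g (e ⟨i, hi⟩) else 0, fun i hi => by simp [hi], ?_⟩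
  intro j hj
  rw [← congrFun hg ⟨j, hj⟩, ← Finset.sum_coe_sort s]
  refine Fintype.sum_equiv e _ _ fun i => ?_
  simp [M, Matrix.vandermonde_apply]

/-- A nonzero weight function on more than `m` points does not vanish against all powers below
`m`. -/
theorem card_support_gt_of_sum_mul_pow_eq_zero [DecidableEq F]
    {s : Finset ι} {p : ι → F} (hp : Set.InjOn p s) {c : ι → F} {m : ℕ}
    (h : ∀ j < m, ∑ i ∈ s, c i * p i ^ j = 0) {a : ι} (ha : a ∈ s) (hca : c a ≠ 0) :
    m < (s.filter fun i => c i ≠ 0).card := by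
  by_contra! hm
  refine hca (eq_zero_of_sum_mul_pow_eq_zero (s := s.filter fun i => c i ≠ 0) (p := p)
    (hp.mono fun i hi => (Finset.mem_filter.1 hi).1) (fun j hj => ?_) a
    (by simp [ha, hca]))
  refine (Finset.sum_subset (Finset.filter_subset _ _) fun i hi hi' => ?_).trans
    (h j (hj.trans_le hm))
  have : c i = 0 := by simpa [hi] using hi'
  simp [this]

end Vandermonde

/-! ### The block code: dimension, distance, locality, optimality. -/

section Construction

variable {F : Type uF} [Field F] {n : ℕ} {β : Type*} [DecidableEq β]

/-- The local syndromes (powers below `l` on each block) together with the global syndromes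
(the next `h` powers). -/
def syndrome (blk : Fin n → β) (pt : Fin n → F) (l h : ℕ) :
    (Fin n → F) →ₗ[F] (β × Fin l → F) × (Fin h → F) where
  toFun c := (fun x => ∑ i with blk i = x.1, c i * pt i ^ (x.2 : ℕ),
    fun j => ∑ i, c i * pt i ^ (l + (j : ℕ)))
  map_add' c c' := by
    ext <;> simp [add_mul, Finset.sum_add_distrib]
  map_smul' a c := by
    ext <;> simp [mul_assoc, Finset.mul_sum]

/-- The code with the `(r, δ)`-repair sets `blk ⁻¹ {x}`, where `l = δ - 1`. -/
def blockCode (blk : Fin n → β) (pt : Fin n → F) (l h : ℕ) : Submodule F (Fin n → F) :=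
  LinearMap.ker (syndrome blk pt l h)

theorem mem_blockCode {blk : Fin n → β} {pt : Fin n → F} {l h : ℕ} {c : Fin n → F} :
    c ∈ blockCode blk pt l h ↔
      (∀ x, ∀ j < l, ∑ i with blk i = x, c i * pt i ^ j = 0) ∧
        ∀ j < h, ∑ i, c i * pt i ^ (l + j) = 0 := by
  rw [blockCode, LinearMap.mem_ker, syndrome, LinearMap.coe_mk, AddHom.coe_mk, Prod.mk_eq_zero]
  refine and_congr ⟨fun H x j hj => congrFun H (x, ⟨j, hj⟩), fun H => ?_⟩
    ⟨fun H j hj => congrFun H ⟨j, hj⟩, fun H => ?_⟩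
  · ext x; exact H x.1 x.2 x.2.2
  · ext j; exact H j j.2

theorem sum_mul_pow_eq_zero_of_mem_blockCode {blk : Fin n → β} {pt : Fin n → F} {l h : ℕ}
    {c : Fin n → F} (hc : c ∈ blockCode blk pt l h) {j : ℕ} (hj : j < l + h) :
    ∑ i, c i * pt i ^ j = 0 := by
  rw [mem_blockCode] at hc
  rcases lt_or_ge j l with hjl | hjl
  · rw [← Finset.sum_fiberwise_of_maps_to (t := Finset.univ.image blk) (g := blk) (by simp)]
    exact Finset.sum_eq_zero fun x _ => hc.1 x j hjl
  · obtain ⟨k, rfl⟩ := Nat.exists_eq_add_of_le hjl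
    exact hc.2 k (by omega)

theorem sum_filter_sum_block [Fintype β] (blk : Fin n → β) (f : β → Fin n → F)
    (hf : ∀ x i, blk i ≠ x → f x i = 0) (g : Fin n → F) (y : β) :
    ∑ i with blk i = y, (∑ x, f x i) * g i = ∑ i with blk i = y, f y i * g i := by
  refine Finset.sum_congr rfl fun i hi => ?_
  rw [Finset.sum_eq_single y]
  · intro x _ hx
    exact hf x i fun h => hx (by rw [← h]; simpa using hi)
  · simp

/-- Blocks have at least `l + h` distinct points, so the first `l + h` power sums can be prescribed
on each block independently. -/
theorem syndrome_surjective [Fintype β] {blk : Fin n → β} {pt : Fin n → F} {l h : ℕ} [Nonempty β]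
    (hinj : ∀ x, Set.InjOn pt {i | blk i = x})
    (hcard : ∀ x, l + h ≤ (Finset.univ.filter fun i => blk i = x).card) :
    Function.Surjective (syndrome blk pt l h) := by
  classical
  rintro ⟨a, g⟩
  obtain ⟨x₀⟩ := ‹Nonempty β›
  -- The global syndrome is produced entirely by the block `x₀`; the other blocks contribute zero in
  -- degrees `l` to `l + h - 1`.
  let t : β → ℕ → F := fun x j =>
    if hj : j < l then a (x, ⟨j, hj⟩)
    else if hj : j - l < h then (if x = x₀ then g ⟨j - l, hj⟩ else 0) else 0
  have H : ∀ x, ∃ c : Fin n → F, (∀ i, blk i ≠ x → c i = 0) ∧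
      ∀ j < l + h, ∑ i with blk i = x, c i * pt i ^ j = t x j := by
    intro x
    obtain ⟨c, hc, hc'⟩ := exists_sum_mul_pow_eq (s := Finset.univ.filter fun i => blk i = x)
      (p := pt) (by simpa using hinj x) (t x)
    exact ⟨c, fun i hi => hc i (by simpa using hi), fun j hj => hc' j (hj.trans_le (hcard x))⟩
  choose f hf hf' using H
  refine ⟨fun i => ∑ x, f x i, ?_⟩
  refine Prod.ext (funext ?_) (funext ?_)
  · rintro ⟨x, j⟩
    change ∑ i with blk i = x, (∑ x, f x i) * pt i ^ (j : ℕ) = a (x, j)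
    rw [sum_filter_sum_block blk f hf (fun i => pt i ^ (j : ℕ)), hf' x j (by omega)]
    simp [t]
  · intro j
    change ∑ i, (∑ x, f x i) * pt i ^ (l + (j : ℕ)) = g j
    rw [← Finset.sum_fiberwise (g := blk)]
    simp_rw [sum_filter_sum_block blk f hf (fun i => pt i ^ (l + (j : ℕ)))]
    rw [Finset.sum_eq_single x₀]
    · rw [hf' x₀ _ (by omega)]; simp [t]
    · intro x _ hx
      rw [hf' x _ (by omega)]; simp [t, hx]
    · simp

theorem finrank_blockCode [Fintype β] {blk : Fin n → β} {pt : Fin n → F} {l h : ℕ} [Nonempty β]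
    (hinj : ∀ x, Set.InjOn pt {i | blk i = x})
    (hcard : ∀ x, l + h ≤ (Finset.univ.filter fun i => blk i = x).card) :
    Module.finrank F (blockCode blk pt l h) + (Fintype.card β * l + h) = n := by
  have h1 := LinearMap.finrank_range_add_finrank_ker (syndrome blk pt l h)
  rw [LinearMap.range_eq_top.2 (syndrome_surjective hinj hcard), finrank_top] at h1
  simp only [Module.finrank_prod, Module.finrank_fintype_fun_eq_card, Fintype.card_prod,
    Fintype.card_fin] at h1
  rw [blockCode]
  omega

variable [DecidableEq F]

/-- Within `l + h + 1` coordinates of one block, take the weights whose power sums vanish below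
degree `l + h` and equal `1` there; the last condition makes the word nonzero. -/
theorem exists_mem_blockCode_hammingNorm_le {blk : Fin n → β} {pt : Fin n → F} {l h : ℕ}
    [Nonempty β] (hinj : ∀ x, Set.InjOn pt {i | blk i = x})
    (hcard : ∀ x, l + h + 1 ≤ (Finset.univ.filter fun i => blk i = x).card) :
    ∃ c ∈ blockCode blk pt l h, c ≠ 0 ∧ hammingNorm c ≤ l + h + 1 := by
  obtain ⟨x₀⟩ := ‹Nonempty β›
  obtain ⟨s, hs, hs'⟩ := Finset.exists_subset_card_eq (hcard x₀)
  have hsb : ∀ i ∈ s, blk i = x₀ := fun i hi => by simpa using hs hi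
  obtain ⟨c, hc, hc'⟩ := exists_sum_mul_pow_eq (s := s) (p := pt)
    ((hinj x₀).mono fun i hi => hsb i hi) (fun j => if j = l + h then 1 else 0)
  have hsum : ∀ j, ∑ i, c i * pt i ^ j = ∑ i ∈ s, c i * pt i ^ j := fun j =>
    (Finset.sum_subset (Finset.subset_univ s) fun i _ hi => by simp [hc i hi]).symm
  refine ⟨c, mem_blockCode.2 ⟨fun x j hj => ?_, fun j hj => ?_⟩, ?_, ?_⟩
  · by_cases hx : x = x₀
    · subst hx
      rw [← Finset.sum_subset hs fun i _ hi => by simp [hc i hi], hc' j (by omega), if_neg (by omega)]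
    · refine Finset.sum_eq_zero fun i hi => ?_
      rw [hc i fun his => hx (by rw [← hsb i his]; exact ((Finset.mem_filter.1 hi).2).symm), zero_mul]
  · rw [hsum, hc' _ (by omega), if_neg (by omega)]
  · rintro rfl
    simpa using hc' (l + h) (by omega)
  · rw [← hs', hammingNorm]
    exact Finset.card_le_card fun i hi => by
      by_contra his
      simp [hc i his] at hi

/-- Low weight forces cancellation between blocks at every point of the support, and the small
intersections leave no room for it. -/
theorem le_hammingNorm_of_mem_blockCode {blk : Fin n → β} {pt : Fin n → F} {l h τ : ℕ}
    (hinj : ∀ x, Set.InjOn pt {i | blk i = x})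
    (hinter : ∀ x y, x ≠ y → ((Finset.univ.filter fun i => blk i = x).image pt ∩
      (Finset.univ.filter fun i => blk i = y).image pt).card ≤ τ)
    (hτ : h * τ ≤ (l + 1) ^ 2) {c : Fin n → F} (hc : c ∈ blockCode blk pt l h) (hc0 : c ≠ 0) :
    l + h + 1 ≤ hammingNorm c := by
  by_contra! hlt
  let s := Finset.univ.filter fun i => c i ≠ 0
  have hs : s.card ≤ l + h := by
    have : s.card = hammingNorm c := rfl
    omega
  -- The support has at most `l + h` distinct points, and all power sums below `l + h` vanish, so
  -- Vandermonde applies to the sums over the fibres of `pt`.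
  have hG : ∀ z ∈ s.image pt, ∑ i ∈ s with pt i = z, c i = 0 := by
    refine eq_zero_of_sum_mul_pow_eq_zero (p := id) Function.injective_id.injOn fun j hj => ?_
    rw [← sum_mul_pow_eq_zero_of_mem_blockCode hc (hj.trans_le (Finset.card_image_le.trans hs)),
      ← Finset.sum_subset (Finset.subset_univ s) fun i _ hi => by
        have : c i = 0 := by simpa [s] using hi
        simp [this],
      ← Finset.sum_fiberwise_of_maps_to (g := pt) fun i hi => Finset.mem_image_of_mem pt hi]
    refine Finset.sum_congr rfl fun z _ => ?_
    rw [Finset.sum_mul]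
    refine Finset.sum_congr rfl fun i hi => ?_
    simp [(Finset.mem_filter.1 hi).2]
  let M := s.image blk
  have hM : ∀ x ∈ M, l + 1 ≤ (s.filter fun i => blk i = x).card := by
    intro x hx
    obtain ⟨a, ha, rfl⟩ := Finset.mem_image.1 hx
    have := card_support_gt_of_sum_mul_pow_eq_zero
      (s := Finset.univ.filter fun i => blk i = blk a) (p := pt) (c := c)
      (by simpa using hinj (blk a)) ((mem_blockCode.1 hc).1 (blk a)) (a := a) (by simp)
      (by simpa [s] using ha)
    rwa [Finset.filter_comm] at this
  have hMs : M.card * (l + 1) ≤ s.card := by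
    rw [Finset.card_eq_sum_card_image blk s]
    exact Finset.card_nsmul_le_sum _ _ _ hM
  obtain ⟨a, ha⟩ : ∃ a, c a ≠ 0 := by
    by_contra! H
    exact hc0 (funext H)
  have haM : blk a ∈ M := Finset.mem_image_of_mem _ (by simp [s, ha])
  have hcover : (s.filter fun i => blk i = blk a).image pt ⊆ (M.erase (blk a)).biUnion fun y =>
      (Finset.univ.filter fun i => blk i = blk a).image pt ∩
        (Finset.univ.filter fun i => blk i = y).image pt := by
    intro z hz
    obtain ⟨i, hi, rfl⟩ := Finset.mem_image.1 hz
    obtain ⟨his, hia⟩ := Finset.mem_filter.1 hi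
    have : ∃ i' ∈ s, pt i' = pt i ∧ i' ≠ i := by
      by_contra! H
      have h1 := hG (pt i) (Finset.mem_image_of_mem _ his)
      rw [Finset.sum_eq_single (a := i)] at h1
      · exact (Finset.mem_filter.1 his).2 h1
      · intro i' hi' hne
        exact absurd (H i' (Finset.mem_filter.1 hi').1 (Finset.mem_filter.1 hi').2) hne
      · intro h2
        exact absurd (by simp [his]) h2
    obtain ⟨i', hi's, hpt, hne⟩ := this
    refine Finset.mem_biUnion.2 ⟨blk i', Finset.mem_erase.2 ⟨fun hb => hne ?_,
      Finset.mem_image_of_mem _ hi's⟩, Finset.mem_inter.2 ⟨?_, ?_⟩⟩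
    · exact hinj (blk a) hb hia hpt
    · exact Finset.mem_image_of_mem _ (by simpa using hia)
    · rw [← hpt]
      exact Finset.mem_image_of_mem _ (by simp)
  have h1 : l + 1 ≤ (M.erase (blk a)).card * τ := by
    refine (hM _ haM).trans ?_
    rw [← Finset.card_image_of_injOn (f := pt) ((hinj (blk a)).mono (by
      intro i hi; simpa using (Finset.mem_filter.1 hi).2))]
    refine (Finset.card_le_card hcover).trans (Finset.card_biUnion_le_card_mul _ _ _ fun y hy => ?_)
    exact hinter _ _ (Finset.ne_of_mem_erase hy).symm
  have h2 : M.card = (M.erase (blk a)).card + 1 := by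
    rw [Finset.card_erase_of_mem haM]
    have := Finset.card_pos.2 ⟨_, haM⟩
    omega
  rw [h2] at hMs
  generalize (M.erase (blk a)).card = m at h1 hMs
  -- With `m` further blocks, `m * δ < h` and `δ ≤ m * τ` (where `δ = l + 1`) give `δ ^ 2 ≤ m * δ *
  -- τ < h * τ`.
  have h3 : m * (l + 1) + 1 ≤ h := by nlinarith
  have h4 : 0 < τ := by
    rcases Nat.eq_zero_or_pos τ with h0 | h0
    · subst h0; simp at h1
    · exact h0
  nlinarith [Nat.mul_le_mul_right τ h3, Nat.mul_le_mul_right (l + 1) h1]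

theorem hasAllSymbolLocality_blockCode {blk : Fin n → β} {pt : Fin n → F} {l h r : ℕ}
    (hinj : ∀ x, Set.InjOn pt {i | blk i = x})
    (hcard : ∀ x, (Finset.univ.filter fun i => blk i = x).card ≤ r + l) :
    HasAllSymbolLocality (blockCode blk pt l h) r (l + 1) := by
  intro j
  refine ⟨Finset.univ.filter fun i => blk i = blk j, by simp, hcard _, ?_⟩
  rintro _ ⟨c, hc, rfl⟩ hc0
  obtain ⟨a, ha⟩ : ∃ a, LinearMap.funLeft F F
      (fun i : (Finset.univ.filter fun i => blk i = blk j) => (i : Fin n)) c a ≠ 0 := by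
    by_contra! H
    exact hc0 (funext H)
  have h1 := card_support_gt_of_sum_mul_pow_eq_zero
      (s := Finset.univ.filter fun i => blk i = blk j) (p := pt) (c := c)
      (by simpa using hinj (blk j)) ((mem_blockCode.1 hc).1 (blk j)) a.2 ha
  refine Nat.succ_le_of_lt (h1.trans_le (le_of_eq ?_))
  rw [hammingNorm]
  symm
  refine Finset.card_bij (fun i _ => (i : Fin n)) ?_ ?_ ?_
  · intro i hi
    exact Finset.mem_filter.2 ⟨i.2, (Finset.mem_filter.1 hi).2⟩
  · intro i _ i' _ hii
    exact Subtype.ext hii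
  · intro i hi
    obtain ⟨hi1, hi2⟩ := Finset.mem_filter.1 hi
    exact ⟨⟨i, hi1⟩, Finset.mem_filter.2 ⟨Finset.mem_univ _, hi2⟩, rfl⟩

theorem isOptimalLRC_blockCode [Fintype β] {blk : Fin n → β} {pt : Fin n → F} {r v δ τ : ℕ} [Nonempty β]
    (hδ : 1 ≤ δ) (hv : 1 ≤ v) (hvr : v ≤ r) (hτ : (r - v) * τ ≤ δ ^ 2)
    (hinj : ∀ x, Set.InjOn pt {i | blk i = x})
    (hcard : ∀ x, (Finset.univ.filter fun i => blk i = x).card = r + δ - 1)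
    (hinter : ∀ x y, x ≠ y → ((Finset.univ.filter fun i => blk i = x).image pt ∩
      (Finset.univ.filter fun i => blk i = y).image pt).card ≤ τ)
    (hn : n = Fintype.card β * (r + δ - 1)) :
    IsOptimalLRC (blockCode blk pt (δ - 1) (r - v)) ((Fintype.card β - 1) * r + v) (r - v + δ)
      r δ := by
  obtain ⟨l, rfl⟩ : ∃ l, δ = l + 1 := ⟨δ - 1, by omega⟩
  obtain ⟨h, rfl⟩ := Nat.exists_eq_add_of_le hvr
  obtain ⟨w, hw⟩ : ∃ w, Fintype.card β = w + 1 :=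
    ⟨Fintype.card β - 1, by have := Fintype.card_pos (α := β); omega⟩
  have hb : v + h + (l + 1) - 1 = v + h + l := by omega
  rw [Nat.add_sub_cancel_left] at hτ
  simp only [hb, hw] at hcard hn
  simp only [Nat.add_sub_cancel_left, Nat.add_sub_cancel, hw]
  have hlb := fun c hc hc0 => le_hammingNorm_of_mem_blockCode (c := c) (h := h) hinj hinter hτ hc hc0
  refine ⟨?_, ⟨?_, ?_⟩, ?_, ?_⟩
  · have := finrank_blockCode (l := l) (h := h) hinj fun x => by rw [hcard]; omega
    rw [hw] at this
    have h2 : n = (w * (v + h) + v) + ((w + 1) * l + h) := by rw [hn]; ring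
    omega
  · obtain ⟨c, hc, hc0, hcn⟩ := exists_mem_blockCode_hammingNorm_le (l := l) (h := h) hinj
      fun x => by rw [hcard]; omega
    exact ⟨c, hc, hc0, by have := hlb c hc hc0; omega⟩
  · rintro _ ⟨c, hc, hc0, rfl⟩
    have := hlb c hc hc0
    omega
  · exact hasAllSymbolLocality_blockCode hinj fun x => (hcard x).le
  · have hceil : ⌈((w * (v + h) + v : ℕ) : ℚ) / ((v + h : ℕ) : ℚ)⌉ = (w : ℤ) + 1 := by
      have hpos : (0 : ℚ) < ((v + h : ℕ) : ℚ) := by exact_mod_cast (by omega : 0 < v + h)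
      have hvq : (0 : ℚ) < v := by exact_mod_cast hv
      have hhq : (0 : ℚ) ≤ h := Nat.cast_nonneg h
      rw [Int.ceil_eq_iff, lt_div_iff₀ hpos, div_le_iff₀ hpos]
      push_cast
      constructor <;> nlinarith
    rw [hceil, hn]
    push_cast
    ring

end Construction

end LRC

namespace LRC

/-! ### Ranks of vanishing subcodes and chains of repair sets. -/

section Vanishing

variable {F : Type uF} [Field F] {n : ℕ}

/-- The subcode of the words of `C` that vanish on `T`. -/
def vanishing (C : Submodule F (Fin n → F)) (T : Finset (Fin n)) : Submodule F (Fin n → F) where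
  carrier := {c | c ∈ C ∧ ∀ i ∈ T, c i = 0}
  add_mem' hx hy := ⟨C.add_mem hx.1 hy.1, fun i hi => by simp [hx.2 i hi, hy.2 i hi]⟩
  zero_mem' := ⟨C.zero_mem, fun _ _ => rfl⟩
  smul_mem' a _ hx := ⟨C.smul_mem a hx.1, fun i hi => by simp [hx.2 i hi]⟩

variable {C : Submodule F (Fin n → F)} {T B R : Finset (Fin n)}

theorem mem_vanishing {c : Fin n → F} : c ∈ vanishing C T ↔ c ∈ C ∧ ∀ i ∈ T, c i = 0 := Iff.rfl

theorem vanishing_empty : vanishing C ∅ = C := by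
  ext c; simp [mem_vanishing]

theorem vanishing_anti (h : B ⊆ T) : vanishing C T ≤ vanishing C B :=
  fun _ hc => ⟨hc.1, fun i hi => hc.2 i (h hi)⟩

theorem finrank_vanishing_le (T B : Finset (Fin n)) :
    Module.finrank F (vanishing C T) ≤ Module.finrank F (vanishing C (T ∪ B)) + B.card := by
  let f : vanishing C T →ₗ[F] (B → F) :=
    (LinearMap.funLeft F F (fun i : B => (i : Fin n))) ∘ₗ (vanishing C T).subtype
  have h1 := LinearMap.finrank_range_add_finrank_ker f
  have h2 : Module.finrank F (LinearMap.range f) ≤ B.card := by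
    simpa using Submodule.finrank_le (LinearMap.range f)
  have h3 : (LinearMap.ker f).map (vanishing C T).subtype = vanishing C (T ∪ B) := by
    ext c
    simp only [Submodule.mem_map, LinearMap.mem_ker, Submodule.subtype_apply]
    constructor
    · rintro ⟨x, hx, rfl⟩
      refine ⟨x.2.1, fun i hi => ?_⟩
      rcases Finset.mem_union.1 hi with hi | hi
      · exact x.2.2 i hi
      · exact congrFun hx ⟨i, hi⟩
    · intro hc
      exact ⟨⟨c, vanishing_anti Finset.subset_union_left hc⟩,
        funext fun i => hc.2 i (Finset.mem_union_right _ i.2), rfl⟩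
  rw [← h3, LinearEquiv.finrank_eq (Submodule.equivSubtypeMap _ _).symm]
  omega

theorem exists_mem_vanishing_ne_zero (h : 0 < Module.finrank F (vanishing C T)) :
    ∃ c ∈ vanishing C T, c ≠ 0 := by
  refine Submodule.exists_mem_ne_zero_of_ne_bot fun h0 => ?_
  rw [h0, finrank_bot] at h
  exact lt_irrefl _ h

variable [DecidableEq F]

/-- The Singleton bound for the subcode of the words that vanish on `T`. -/
theorem finrank_vanishing_add_card_le {d : ℕ} (hd : ∀ c ∈ C, c ≠ 0 → d ≤ hammingNorm c)
    (h : 0 < Module.finrank F (vanishing C T)) :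
    Module.finrank F (vanishing C T) + T.card + d ≤ n + 1 := by
  have h0 : Module.finrank F (vanishing C T) ≤ Tᶜ.card := by
    have := finrank_vanishing_le (C := C) T Tᶜ
    rw [Finset.union_compl] at this
    have h1 : vanishing C Finset.univ = ⊥ := by
      refine (Submodule.eq_bot_iff _).2 fun c hc => funext fun i => hc.2 i (Finset.mem_univ i)
    rwa [h1, finrank_bot, zero_add] at this
  -- Killing one coordinate fewer than the rank still leaves a nonzero word, whose weight is then
  -- bounded above.
  obtain ⟨B, hB, hBc⟩ := Finset.exists_subset_card_eq
    (show Module.finrank F (vanishing C T) - 1 ≤ Tᶜ.card by omega)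
  have h1 := finrank_vanishing_le (C := C) T B
  obtain ⟨c, hc, hc0⟩ := exists_mem_vanishing_ne_zero (C := C) (T := T ∪ B) (by omega)
  have h2 : hammingNorm c + (T ∪ B).card ≤ n := by
    rw [hammingNorm, ← Finset.card_union_of_disjoint]
    · exact (Finset.card_le_univ _).trans (by simp)
    · rw [Finset.disjoint_left]
      intro i hi hi'
      exact (Finset.mem_filter.1 hi).2 (hc.2 i hi')
  rw [Finset.card_union_of_disjoint
    (Finset.disjoint_left.2 fun i hi hi' => Finset.mem_compl.1 (hB hi') hi)] at h2
  have := hd c hc.1 hc0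
  omega

theorem le_card_filter_of_minDistAtLeast {δ : ℕ} (hR : MinDistAtLeast (puncture C R) δ)
    {c : Fin n → F} (hc : c ∈ C) {a : Fin n} (ha : a ∈ R) (hca : c a ≠ 0) :
    δ ≤ (R.filter fun i => c i ≠ 0).card := by
  refine (hR _ (Submodule.mem_map_of_mem hc) fun h => hca (congrFun h ⟨a, ha⟩)).trans (le_of_eq ?_)
  rw [hammingNorm]
  refine Finset.card_bij (fun i _ => (i : Fin n)) ?_ ?_ ?_
  · intro i hi
    exact Finset.mem_filter.2 ⟨i.2, (Finset.mem_filter.1 hi).2⟩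
  · intro i _ i' _ hii
    exact Subtype.ext hii
  · intro i hi
    obtain ⟨hi1, hi2⟩ := Finset.mem_filter.1 hi
    exact ⟨⟨i, hi1⟩, Finset.mem_filter.2 ⟨Finset.mem_univ _, hi2⟩, rfl⟩

theorem eq_zero_of_minDistAtLeast {δ : ℕ} (hδ : 1 ≤ δ) (hR : MinDistAtLeast (puncture C R) δ)
    {c : Fin n → F} (hc : c ∈ C) {A : Finset (Fin n)} (hA : A.card ≤ δ - 1)
    (h : ∀ i ∈ R, i ∉ A → c i = 0) : ∀ i ∈ R, c i = 0 := by
  intro a ha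
  by_contra hca
  have h1 := le_card_filter_of_minDistAtLeast hR hc ha hca
  have h2 : (R.filter fun i => c i ≠ 0).card ≤ A.card := Finset.card_le_card fun i hi => by
    obtain ⟨hi1, hi2⟩ := Finset.mem_filter.1 hi
    by_contra hiA
    exact hi2 (h i hi1 hiA)
  omega

theorem le_card_sdiff_of_mem_vanishing {δ : ℕ} (hR : MinDistAtLeast (puncture C R) δ)
    {c : Fin n → F} (hc : c ∈ vanishing C T) {a : Fin n} (ha : a ∈ R) (hca : c a ≠ 0) :
    δ ≤ (R \ T).card := by
  refine (le_card_filter_of_minDistAtLeast hR hc.1 ha hca).trans (Finset.card_le_card ?_)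
  intro i hi
  obtain ⟨hi1, hi2⟩ := Finset.mem_filter.1 hi
  exact Finset.mem_sdiff.2 ⟨hi1, fun h => hi2 (hc.2 i h)⟩

/-- The last `δ - 1` new coordinates of a repair set are free: a codeword zero on the rest of `R` is
zero on `R`. -/
theorem finrank_vanishing_union_repair {δ : ℕ} (hδ : 1 ≤ δ)
    (hR : MinDistAtLeast (puncture C R) δ) (h : δ - 1 ≤ (R \ T).card) :
    Module.finrank F (vanishing C T) + (δ - 1) ≤
      Module.finrank F (vanishing C (T ∪ R)) + (R \ T).card := by
  obtain ⟨A, hA, hAc⟩ := Finset.exists_subset_card_eq h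
  have h1 := finrank_vanishing_le (C := C) T ((R \ T) \ A)
  have h2 : vanishing C (T ∪ (R \ T) \ A) ≤ vanishing C (T ∪ R) := by
    intro c hc
    have h0 := eq_zero_of_minDistAtLeast hδ hR hc.1 hAc.le fun i hi hiA => by
      by_cases hiT : i ∈ T
      · exact hc.2 i (Finset.mem_union_left _ hiT)
      · exact hc.2 i (Finset.mem_union_right _ (by simp [hi, hiA, hiT]))
    refine ⟨hc.1, fun i hi => ?_⟩
    rcases Finset.mem_union.1 hi with hi | hi
    · exact hc.2 i (Finset.mem_union_left _ hi)
    · exact h0 i hi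
  have h3 := Submodule.finrank_mono h2
  rw [Finset.card_sdiff_of_subset hA] at h1
  omega

/-- Greedy choice of repair sets, each contributing at least `δ` new coordinates. -/
theorem exists_repair_chain {r δ : ℕ} (hδ : 1 ≤ δ) (hC : HasAllSymbolLocality C r δ)
    (T : Finset (Fin n)) (s : ℕ) (hs : s * r < Module.finrank F (vanishing C T) + r) :
    ∃ R : ℕ → Finset (Fin n),
      (∀ i < s, (R i).card ≤ r + δ - 1 ∧ MinDistAtLeast (puncture C (R i)) δ ∧
        δ ≤ (R i \ (T ∪ (Finset.range i).biUnion R)).card) ∧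
      Module.finrank F (vanishing C T) ≤
        Module.finrank F (vanishing C (T ∪ (Finset.range s).biUnion R)) + s * r ∧
      Module.finrank F (vanishing C T) + s * (δ - 1) + T.card ≤
        Module.finrank F (vanishing C (T ∪ (Finset.range s).biUnion R)) +
          (T ∪ (Finset.range s).biUnion R).card := by
  induction s with
  | zero =>
    have h0 : T ∪ (Finset.range 0).biUnion (fun _ : ℕ => (∅ : Finset (Fin n))) = T := by simp
    refine ⟨fun _ => ∅, by simp, ?_, ?_⟩ <;> rw [h0] <;> omega
  | succ s ih =>
    rw [add_mul, one_mul] at hs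
    obtain ⟨R, hR, hr1, hr2⟩ := ih (by omega)
    -- Each step costs rank at most `r`, so `hs` leaves a nonzero word here. The repair set of a
    -- coordinate where it is nonzero has at least `δ` coordinates outside the current union.
    obtain ⟨c, hc, hc0⟩ := exists_mem_vanishing_ne_zero (C := C)
      (T := T ∪ (Finset.range s).biUnion R) (by omega)
    obtain ⟨a, ha⟩ : ∃ a, c a ≠ 0 := by
      by_contra! H
      exact hc0 (funext H)
    obtain ⟨R', haR', hR'c, hR'⟩ := hC a
    have hU : ∀ i ≤ s, (Finset.range i).biUnion (Function.update R s R') =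
        (Finset.range i).biUnion R := fun i hi =>
      Finset.biUnion_congr rfl fun j hj => by
        rw [Function.update_of_ne]
        have := Finset.mem_range.1 hj
        omega
    have hδ' := le_card_sdiff_of_mem_vanishing hR' hc haR' ha
    have h1 := finrank_vanishing_union_repair hδ hR' (by omega :
      δ - 1 ≤ (R' \ (T ∪ (Finset.range s).biUnion R)).card)
    have h2 := Finset.card_le_card (Finset.sdiff_subset (s := R')
      (t := T ∪ (Finset.range s).biUnion R))
    have hs1 : T ∪ (Finset.range (s + 1)).biUnion (Function.update R s R') =
        T ∪ (Finset.range s).biUnion R ∪ R' := by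
      rw [Finset.range_add_one, Finset.biUnion_insert, hU s le_rfl, Function.update_self,
        Finset.union_comm R', Finset.union_assoc]
    refine ⟨Function.update R s R', fun i hi => ?_, ?_, ?_⟩
    · rw [hU i (by omega)]
      rcases Nat.lt_succ_iff_lt_or_eq.1 hi with hi | rfl
      · rw [Function.update_of_ne hi.ne]
        exact hR i hi
      · rw [Function.update_self]
        exact ⟨hR'c, hR', hδ'⟩
    · rw [hs1, add_mul, one_mul]
      omega
    · rw [hs1, add_mul, one_mul]
      have h3 := Finset.card_sdiff_add_card R' (T ∪ (Finset.range s).biUnion R)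
      rw [Finset.union_comm R'] at h3
      omega

end Vanishing

end LRC

namespace LRC

/-! ### Private parts and a convexity estimate. -/

section PrivateParts

variable {α : Type*} [DecidableEq α]

/-- The elements of `R i` that lie in no other member of the family `R 0, …, R (w - 1)`. -/
def privatePart (R : ℕ → Finset α) (w i : ℕ) : Finset α :=
  R i \ ((Finset.range w).erase i).biUnion R

theorem mem_privatePart {R : ℕ → Finset α} {w i : ℕ} {a : α} :
    a ∈ privatePart R w i ↔ a ∈ R i ∧ ∀ j < w, j ≠ i → a ∉ R j := by
  simp only [privatePart, Finset.mem_sdiff, Finset.mem_biUnion, Finset.mem_erase, Finset.mem_range]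
  refine and_congr_right fun _ => ⟨fun H j hj hji hja => H ⟨j, ⟨hji, hj⟩, hja⟩, ?_⟩
  rintro H ⟨j, ⟨hji, hj⟩, hja⟩
  exact H j hj hji hja

/-- A covered element lies in at least two members, or in exactly one and then also in its private
part; either way it is counted twice on the right. -/
theorem two_mul_card_biUnion_le (R : ℕ → Finset α) (w : ℕ) :
    2 * ((Finset.range w).biUnion R).card ≤
      ∑ i ∈ Finset.range w, (R i).card + ∑ i ∈ Finset.range w, (privatePart R w i).card := by
  have h1 : ∀ (f : ℕ → Finset α), (∀ i, f i ⊆ R i) → ∑ i ∈ Finset.range w, (f i).card =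
      ∑ a ∈ (Finset.range w).biUnion R, ((Finset.range w).filter fun i => a ∈ f i).card := by
    intro f hf
    have := Finset.sum_card_bipartiteAbove_eq_sum_card_bipartiteBelow (s := Finset.range w)
      (t := (Finset.range w).biUnion R) (fun i a => a ∈ f i)
    refine Eq.trans ?_ this
    refine Finset.sum_congr rfl fun i hi => congrArg _ ?_
    ext a
    simp only [Finset.mem_bipartiteAbove]
    exact ⟨fun h => ⟨Finset.mem_biUnion.2 ⟨i, hi, hf i h⟩, h⟩, fun h => h.2⟩
  rw [h1 R fun i => subset_rfl, h1 (privatePart R w) fun i => Finset.sdiff_subset,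
    ← Finset.sum_add_distrib, mul_comm, ← smul_eq_mul]
  refine Finset.card_nsmul_le_sum _ _ _ fun a ha => ?_
  obtain ⟨i, hi, hia⟩ := Finset.mem_biUnion.1 ha
  have hpos : 0 < ((Finset.range w).filter fun i => a ∈ R i).card :=
    Finset.card_pos.2 ⟨i, by simp [hia, Finset.mem_range.1 hi]⟩
  by_cases hp : a ∈ privatePart R w i
  · have : 0 < ((Finset.range w).filter fun i => a ∈ privatePart R w i).card :=
      Finset.card_pos.2 ⟨i, by simp [hp, Finset.mem_range.1 hi]⟩
    omega
  · have : ∃ j < w, j ≠ i ∧ a ∈ R j := by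
      by_contra! H
      exact hp (mem_privatePart.2 ⟨hia, H⟩)
    obtain ⟨j, hj, hji, hja⟩ := this
    have : 1 < ((Finset.range w).filter fun i => a ∈ R i).card :=
      Finset.one_lt_card.2 ⟨i, by simp [hia, Finset.mem_range.1 hi], j, by simp [hj, hja], hji.symm⟩
    omega

end PrivateParts

/-- The secant of `p ↦ p.choose δ` through `p = δ` and `p = δ + 1`; it turns a bound on the total
size of the private parts into one on their `δ`-subsets. -/
theorem one_add_mul_le_choose_add_sq {δ : ℕ} (hδ : 1 ≤ δ) (p : ℕ) :
    1 + δ * p ≤ p.choose δ + δ ^ 2 := by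
  rcases lt_or_ge p δ with h | h
  · obtain ⟨e, rfl⟩ := Nat.exists_eq_add_of_lt h
    nlinarith
  · induction p, h using Nat.le_induction with
    | base => simp; nlinarith
    | succ p hp ih =>
      obtain ⟨l, rfl⟩ : ∃ l, δ = l + 1 := ⟨δ - 1, by omega⟩
      have h1 : l + 1 ≤ p.choose l := by
        have := Nat.choose_le_choose l hp
        rwa [Nat.choose_succ_self_right] at this
      rw [Nat.choose_succ_succ]
      linarith

/-! ### Counting cosets to bound the number of repair sets. -/

section Counting

variable {F : Type uF} [Field F] [DecidableEq F] {n : ℕ} {C : Submodule F (Fin n → F)}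

/-- A word that agrees on each `R i` with a codeword vanishes if it vanishes outside of `⋃ A i`. -/
theorem eq_zero_of_locally_mem {δ w : ℕ} (hδ : 1 ≤ δ) {R A : ℕ → Finset (Fin n)}
    (hR : ∀ i < w, MinDistAtLeast (puncture C (R i)) δ)
    (hA : ∀ i < w, A i ⊆ R i \ (Finset.range i).biUnion R) (hAc : ∀ i < w, (A i).card ≤ δ - 1)
    {x : Fin n → F} (hx : ∀ i < w, ∃ c ∈ C, ∀ a ∈ R i, c a = x a)
    (h0 : ∀ a, (∀ i < w, a ∉ A i) → x a = 0) : x = 0 := by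
  have h1 : ∀ i < w, ∀ a ∈ R i, x a = 0 := by
    intro i
    induction i using Nat.strong_induction_on with
    | _ i ih =>
      intro hi a ha
      obtain ⟨c, hc, hcx⟩ := hx i hi
      rw [← hcx a ha]
      refine eq_zero_of_minDistAtLeast hδ (hR i hi) hc (hAc i hi) (fun a ha haA => ?_) a ha
      rw [hcx a ha]
      by_cases hj : ∃ j < w, a ∈ A j
      · obtain ⟨j, hjw, haj⟩ := hj
        obtain ⟨haR, haU⟩ := Finset.mem_sdiff.1 (hA j hjw haj)
        rcases lt_trichotomy j i with hji | rfl | hji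
        · exact ih j hji hjw a haR
        · exact absurd haj haA
        · exact absurd (Finset.mem_biUnion.2 ⟨i, Finset.mem_range.2 hji, ha⟩) haU
      · exact h0 a fun j hjw haj => hj ⟨j, hjw, haj⟩
  funext a
  by_cases hj : ∃ j < w, a ∈ A j
  · obtain ⟨j, hjw, haj⟩ := hj
    exact h1 j hjw a (Finset.mem_sdiff.1 (hA j hjw haj)).1
  · exact h0 a fun j hjw haj => hj ⟨j, hjw, haj⟩

/-- If the punctured code on `R` is large enough, then every `δ`-subset of `R` is the support, within
`R`, of a codeword. -/
theorem exists_mem_support_eq {δ : ℕ} {R A : Finset (Fin n)}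
    (hR : MinDistAtLeast (puncture C R) δ)
    (hk : Module.finrank F (vanishing C R) + R.card < Module.finrank F C + δ)
    (hA : A ⊆ R) (hAc : A.card = δ) :
    ∃ x : Fin n → F, (∀ a, x a ≠ 0 ↔ a ∈ A) ∧ ∃ c ∈ C, ∀ a ∈ R, c a = x a := by
  have h1 := finrank_vanishing_le (C := C) ∅ (R \ A)
  rw [vanishing_empty, Finset.empty_union, Finset.card_sdiff_of_subset hA] at h1
  have h2 := Finset.card_le_card hA
  -- Vanishing on `R \ A` imposes at most `R.card - δ` conditions, fewer than the rank of `C` on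
  -- `R`. The local distance then forces the support within `R` to fill `A`.
  obtain ⟨c, hc, hcR⟩ : ∃ c ∈ vanishing C (R \ A), c ∉ vanishing C R := by
    by_contra! H
    have := Submodule.finrank_mono (show vanishing C (R \ A) ≤ vanishing C R from H)
    omega
  have h3 : ∃ a ∈ R, c a ≠ 0 := by
    by_contra! H
    exact hcR ⟨hc.1, H⟩
  obtain ⟨a, ha, hca⟩ := h3
  have h4 := le_card_filter_of_minDistAtLeast hR hc.1 ha hca
  have h5 : (R.filter fun i => c i ≠ 0) ⊆ A := fun i hi => by
    obtain ⟨hi1, hi2⟩ := Finset.mem_filter.1 hi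
    by_contra hiA
    exact hi2 (hc.2 i (Finset.mem_sdiff.2 ⟨hi1, hiA⟩))
  have h6 := Finset.eq_of_subset_of_card_le h5 (by omega)
  refine ⟨fun i => if i ∈ A then c i else 0, fun i => ?_, c, hc.1, fun i hi => ?_⟩
  · by_cases hi : i ∈ A
    · have : i ∈ R.filter fun i => c i ≠ 0 := h6 ▸ hi
      simpa [hi] using (Finset.mem_filter.1 this).2
    · simp [hi]
  · by_cases hiA : i ∈ A
    · simp [hiA]
    · simp [hiA, hc.2 i (Finset.mem_sdiff.2 ⟨hi, hiA⟩)]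

/-- A packing argument in the space of words agreeing with a codeword on each `R i`. Such words are
determined off `δ - 1` fresh coordinates per repair set, and the weight-`δ` words on private parts
represent distinct cosets of `C`. -/
theorem sub_one_mul_sum_choose_le [Fintype F] {δ w d : ℕ} (hδ : 1 ≤ δ)
    (hd : ∀ c ∈ C, c ≠ 0 → d ≤ hammingNorm c) (hdδ : 2 * δ < d) {R : ℕ → Finset (Fin n)}
    (hR : ∀ i < w, MinDistAtLeast (puncture C (R i)) δ)
    (hfresh : ∀ i < w, δ - 1 ≤ (R i \ (Finset.range i).biUnion R).card)
    (hk : ∀ i < w, Module.finrank F (vanishing C (R i)) + (R i).card < Module.finrank F C + δ) :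
    ((Fintype.card F - 1) * ∑ i ∈ Finset.range w, (privatePart R w i).card.choose δ) *
      Fintype.card F ^ Module.finrank F C ≤ Fintype.card F ^ (n - w * (δ - 1)) := by
  classical
  have hA : ∀ i, ∃ A, i < w → A ⊆ R i \ (Finset.range i).biUnion R ∧ A.card = δ - 1 := by
    intro i
    by_cases hi : i < w
    · obtain ⟨A, h⟩ := Finset.exists_subset_card_eq (hfresh i hi)
      exact ⟨A, fun _ => h⟩
    · exact ⟨∅, fun h => absurd h hi⟩
  choose A hA using hA
  have hx : ∀ (i : Fin w) (B : Finset.powersetCard δ (privatePart R w i)), ∃ x : Fin n → F,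
      (∀ a, x a ≠ 0 ↔ a ∈ B.1) ∧ ∃ c ∈ C, ∀ a ∈ R i, c a = x a := by
    intro i B
    obtain ⟨h1, h2⟩ := Finset.mem_powersetCard.1 B.2
    exact exists_mem_support_eq (hR i i.2) (hk i i.2) (h1.trans Finset.sdiff_subset) h2
  choose x hxs hxc using hx
  have hxloc : ∀ (i : Fin w) (B : Finset.powersetCard δ (privatePart R w i)), ∀ j < w,
      ∃ c ∈ C, ∀ a ∈ R j, c a = x i B a := by
    intro i B j hj
    by_cases hji : j = i
    · subst hji; exact hxc _ B
    · refine ⟨0, C.zero_mem, fun a ha => ?_⟩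
      by_contra h
      have h1 := (hxs i B a).1 fun h' => h (by simp [h'])
      exact (mem_privatePart.1 ((Finset.mem_powersetCard.1 B.2).1 h1)).2 j hj hji ha
  let Z := Finset.univ \ (Finset.range w).biUnion A
  let ψ : ((Σ i : Fin w, Finset.powersetCard δ (privatePart R w i)) × Fˣ) × C → (Z → F) :=
    fun y a => (y.1.2 : F) * x y.1.1.1 y.1.1.2 a + (y.2 : Fin n → F) a
  have hψ : Function.Injective ψ := by
    rintro ⟨⟨⟨i, B⟩, s⟩, c⟩ ⟨⟨⟨j, B'⟩, t⟩, c'⟩ h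
    let z : Fin n → F := fun a => (s : F) * x i B a - (t : F) * x j B' a
    have hsum : z + ((c : Fin n → F) - c') = 0 := by
      refine eq_zero_of_locally_mem hδ hR (fun i hi => (hA i hi).1) (fun i hi => (hA i hi).2.le)
        (fun m hm => ?_) fun a ha => ?_
      · obtain ⟨e, he, he'⟩ := hxloc i B m hm
        obtain ⟨f, hf, hf'⟩ := hxloc j B' m hm
        refine ⟨((s : F) • e - (t : F) • f) + (c - c'), C.add_mem (C.sub_mem (C.smul_mem _ he)
          (C.smul_mem _ hf)) (C.sub_mem c.2 c'.2), fun a ha => ?_⟩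
        simp [z, he' a ha, hf' a ha]
      · have haZ : a ∈ Z := by simpa [Z] using ha
        have h1 : (s : F) * x i B a + (c : Fin n → F) a = (t : F) * x j B' a + (c' : Fin n → F) a :=
          congrFun h ⟨a, haZ⟩
        simp only [z, Pi.add_apply, Pi.sub_apply]
        linear_combination h1
    have hzC : z ∈ C := by
      rw [eq_neg_of_add_eq_zero_left hsum]
      exact C.neg_mem (C.sub_mem c.2 c'.2)
    have hz0 : z = 0 := by
      by_contra hz
      have h1 := hd z hzC hz
      have h2 : hammingNorm z ≤ (B.1 ∪ B'.1).card := by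
        refine Finset.card_le_card fun a ha => ?_
        by_contra haB
        rw [Finset.mem_union, not_or, ← hxs i B a, ← hxs j B' a, not_not, not_not] at haB
        simp [z, haB.1, haB.2] at ha
      have h3 := Finset.card_union_le B.1 B'.1
      rw [(Finset.mem_powersetCard.1 B.2).2, (Finset.mem_powersetCard.1 B'.2).2] at h3
      omega
    have hst : ∀ a, (s : F) * x i B a = t * x j B' a := fun a => sub_eq_zero.1 (congrFun hz0 a)
    have hBB : B.1 = B'.1 := by
      ext a
      rw [← hxs i B a, ← hxs j B' a, ← mul_ne_zero_iff_left (a := (s : F)) s.ne_zero, hst a,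
        mul_ne_zero_iff_left t.ne_zero]
    have hBne : B.1.Nonempty := Finset.card_pos.1 (by
      rw [(Finset.mem_powersetCard.1 B.2).2]; omega)
    obtain ⟨a, ha⟩ := hBne
    have hij : i = j := by
      by_contra hij
      exact (mem_privatePart.1 ((Finset.mem_powersetCard.1 B.2).1 ha)).2 j j.2
        (fun h => hij (Fin.ext h.symm))
        (mem_privatePart.1 ((Finset.mem_powersetCard.1 B'.2).1 (hBB ▸ ha))).1
    subst hij
    obtain rfl : B = B' := Subtype.ext hBB
    have hs : s = t := Units.ext (mul_right_cancel₀ ((hxs i B a).2 ha) (hst a))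
    subst hs
    have hcc : c = c' := by
      rw [hz0, zero_add, sub_eq_zero] at hsum
      exact Subtype.ext hsum
    rw [hcc]
  have h := Fintype.card_le_of_injective ψ hψ
  have hZ : Z.card = n - w * (δ - 1) := by
    have h1 : ((Finset.range w).biUnion A).card = w * (δ - 1) := by
      rw [Finset.card_biUnion, Finset.sum_congr rfl fun i hi => (hA i (Finset.mem_range.1 hi)).2]
      · simp
      · intro i hi j hj hij
        have key : ∀ i j, i < j → j < w → i < w → Disjoint (A i) (A j) := by
          intro i j hij hj hi
          rw [Finset.disjoint_left]
          intro a hai haj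
          exact (Finset.mem_sdiff.1 ((hA j hj).1 haj)).2 (Finset.mem_biUnion.2
            ⟨i, Finset.mem_range.2 hij, (Finset.mem_sdiff.1 ((hA i hi).1 hai)).1⟩)
        rcases lt_or_gt_of_ne hij with h | h
        · exact key i j h (Finset.mem_range.1 hj) (Finset.mem_range.1 hi)
        · exact (key j i h (Finset.mem_range.1 hi) (Finset.mem_range.1 hj)).symm
    rw [Finset.card_sdiff_of_subset (Finset.subset_univ _), h1, Finset.card_univ, Fintype.card_fin]
  simp only [Fintype.card_prod, Fintype.card_sigma, Fintype.card_coe, Finset.card_powersetCard,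
    Fintype.card_fun, Fintype.card_units, hZ] at h
  rw [Module.card_eq_pow_finrank (K := F) (V := C),
    Fin.sum_univ_eq_sum_range (fun i => (privatePart R w i).card.choose δ) w, mul_comm (∑ i ∈ _, _)] at h
  exact h

/-- Upper bound for the number `w` of repair sets of an optimal code with minimum distance
`2 δ + 1`. -/
theorem mul_sub_one_le_of_isOptimalLRC [Fintype F] {r δ v w d : ℕ} (hδ : 2 ≤ δ) (hv : 1 ≤ v)
    (hr : r = v + δ + 1) (hw : 2 * δ + 5 ≤ w) (hloc : HasAllSymbolLocality C r δ)
    (hn : n = w * (r + δ - 1)) (hk : Module.finrank F C = (w - 1) * r + v)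
    (hdd : d = 2 * δ + 1) (hd : ∀ c ∈ C, c ≠ 0 → d ≤ hammingNorm c) :
    w * r * (Fintype.card F - 1) ≤ Fintype.card F ^ (δ + 1) := by
  obtain ⟨w, rfl⟩ : ∃ u, w = u + 2 := ⟨w - 2, by omega⟩
  obtain ⟨l, rfl⟩ : ∃ l, δ = l + 1 := ⟨δ - 1, by omega⟩
  have hk' : Module.finrank F C = (w + 1) * r + v := hk
  have hb : r + (l + 1) - 1 = r + l := by omega
  rw [hb] at hn
  have hn' : n + 1 = (w + 2) * r + (w + 2) * l + 1 := by rw [hn]; ring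
  obtain ⟨R, hR, -, hsize⟩ := exists_repair_chain (by omega) hloc ∅ (w + 2) (by
    rw [vanishing_empty, hk']; nlinarith)
  simp only [Finset.empty_union, hb] at hR
  rw [Finset.empty_union, vanishing_empty, Finset.card_empty, Nat.add_sub_cancel, hk'] at hsize
  have hrank : ∀ i < w + 2, Module.finrank F (vanishing C (R i)) + (R i).card <
      Module.finrank F C + (l + 1) := by
    intro i hi
    obtain ⟨hRc, hRd, hRf⟩ := hR i hi
    -- Extend `R i` by `w` more repair sets, which leaves positive rank, and apply the Singleton
    -- bound; the optimal parameters make the code on `R i` have rank at least `(R i).card - l`.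
    have h0 : l + 1 ≤ (R i).card := hRf.trans (Finset.card_le_card Finset.sdiff_subset)
    have h1 := finrank_vanishing_union_repair (T := ∅) (by omega) hRd (by
      rw [Finset.sdiff_empty]; omega)
    rw [vanishing_empty, Finset.empty_union, Finset.sdiff_empty, Nat.add_sub_cancel] at h1
    obtain ⟨R', -, h2, h3⟩ := exists_repair_chain (by omega) hloc (R i) w (by nlinarith)
    have h4 := finrank_vanishing_add_card_le hd (T := R i ∪ (Finset.range w).biUnion R')
      (by nlinarith)
    rw [Nat.add_sub_cancel] at h3
    rw [hk']
    nlinarith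
  have hcount := sub_one_mul_sum_choose_le (by omega) hd (by omega) (fun i hi => (hR i hi).2.1)
    (fun i hi => by have := (hR i hi).2.2; omega) hrank
  have hcard : (w + 2) * (r + l) ≤ ((Finset.range (w + 2)).biUnion R).card + (l + 2) := by
    -- If rank remained, the Singleton bound would contradict `hsize`, as `l ≥ 1`; so the union
    -- determines the codewords and misses few coordinates.
    rcases Nat.eq_zero_or_pos
      (Module.finrank F (vanishing C ((Finset.range (w + 2)).biUnion R))) with h0 | h0
    · rw [h0] at hsize
      nlinarith
    · have := finrank_vanishing_add_card_le hd h0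
      nlinarith
  have hpriv := two_mul_card_biUnion_le R (w + 2)
  have hsum : ∑ i ∈ Finset.range (w + 2), (R i).card ≤ (w + 2) * (r + l) := by
    have := Finset.sum_le_card_nsmul (Finset.range (w + 2)) (fun i => (R i).card) (r + l)
      fun i hi => (hR i (Finset.mem_range.1 hi)).1
    simpa using this
  have hchoose : (w + 2) + (l + 1) * ∑ i ∈ Finset.range (w + 2), (privatePart R (w + 2) i).card ≤
      ∑ i ∈ Finset.range (w + 2), (privatePart R (w + 2) i).card.choose (l + 1) +
        (w + 2) * (l + 1) ^ 2 := by
    have := Finset.sum_le_sum fun i (_ : i ∈ Finset.range (w + 2)) =>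
      one_add_mul_le_choose_add_sq (δ := l + 1) (by omega) (privatePart R (w + 2) i).card
    simpa [Finset.sum_add_distrib, Finset.mul_sum] using this
  have hmain : (w + 2) * r ≤
      ∑ i ∈ Finset.range (w + 2), (privatePart R (w + 2) i).card.choose (l + 1) := by
    generalize ∑ i ∈ Finset.range (w + 2), (privatePart R (w + 2) i).card.choose (l + 1) = S at *
    generalize ∑ i ∈ Finset.range (w + 2), (privatePart R (w + 2) i).card = P at *
    have hP : (w + 2) * (r + l) ≤ P + 2 * (l + 2) := by omega
    have hP' := Nat.mul_le_mul_left (l + 1) hP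
    -- The secant bound reduces the goal to this: the overlap loss `2 * δ * (δ + 1)` against the
    -- gain `(δ - 1) * (r - 1)` per repair set.
    have hl : 2 * (l + 1) * (1 * (l + 2)) ≤ (w + 2) * (l * (v + l + 1)) :=
      Nat.mul_le_mul (by omega) (Nat.mul_le_mul (by omega) (by omega))
    subst hr
    linarith
  have hq : 0 < Fintype.card F := Fintype.card_pos
  have hexp : n - (w + 2) * (l + 1 - 1) = (l + 1 + 1) + Module.finrank F C := by
    rw [hk', Nat.add_sub_cancel]
    have : n = (w + 1) * r + r + (w + 2) * l := by rw [hn]; ring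
    omega
  rw [hexp, pow_add] at hcount
  have := Nat.le_of_mul_le_mul_right hcount (pow_pos hq _)
  rw [mul_comm]
  exact (Nat.mul_le_mul_left _ hmain).trans this

end Counting

end LRC

namespace LRC

/-! ### Packings, Steiner systems and the codes they give. -/

section Packing

variable {X : Type uX} [Fintype X] {t n₁ b : ℕ} {S : Finset (Finset X)}

theorem IsPacking.card_inter_lt [DecidableEq X] (hS : IsPacking t n₁ b S) {B B' : Finset X}
    (hB : B ∈ S) (hB' : B' ∈ S) (hne : B ≠ B') : (B ∩ B').card < t := by
  by_contra! h
  obtain ⟨T, hT, hTc⟩ := Finset.exists_subset_card_eq h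
  exact hne (hS.at_most_one T hTc B hB B' hB' (hT.trans Finset.inter_subset_left)
    (hT.trans Finset.inter_subset_right))

theorem IsPacking.le_card_points (hS : IsPacking t n₁ b S) (hne : S.Nonempty) : b ≤ n₁ := by
  obtain ⟨B, hB⟩ := hne
  rw [← hS.card_block B hB, ← hS.card_points]
  exact Finset.card_le_univ B

theorem IsPacking.card_le_pow (hS : IsPacking t n₁ b S) {q : ℕ} (hq : n₁ ≤ q) (hq0 : 0 < q) :
    S.card ≤ q ^ t := by
  classical
  -- The minimum covers `b < t`, where the packing condition is empty and a block serves as its own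
  -- label.
  have h1 : ∀ B : Finset X, ∃ T, B ∈ S → T ⊆ B ∧ T.card = min t b := by
    intro B
    by_cases hB : B ∈ S
    · obtain ⟨T, hT⟩ := Finset.exists_subset_card_eq
        (show min t b ≤ B.card by rw [hS.card_block B hB]; exact min_le_right _ _)
      exact ⟨T, fun _ => hT⟩
    · exact ⟨∅, fun h => absurd h hB⟩
  choose T hT using h1
  have h2 : S.card ≤ (Finset.powersetCard (min t b) (Finset.univ : Finset X)).card := by
    refine Finset.card_le_card_of_injOn T (fun B hB => ?_) fun B hB B' hB' h => ?_
    · exact Finset.mem_coe.2 (Finset.mem_powersetCard.2 ⟨Finset.subset_univ _, (hT B hB).2⟩)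
    · rcases le_total t b with htb | htb
      · refine hS.at_most_one (T B) ?_ B hB B' hB' (hT B hB).1 (h ▸ (hT B' hB').1)
        rw [(hT B hB).2, min_eq_left htb]
      · have h3 : ∀ B ∈ S, T B = B := fun B hB => Finset.eq_of_subset_of_card_le (hT B hB).1 (by
          rw [(hT B hB).2, min_eq_right htb, hS.card_block B hB])
        rw [← h3 B hB, h, h3 B' hB']
  rw [Finset.card_powersetCard, Finset.card_univ, hS.card_points] at h2
  calc S.card ≤ n₁ ^ min t b := h2.trans (Nat.choose_le_pow _ _)
    _ ≤ q ^ min t b := Nat.pow_le_pow_left hq _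
    _ ≤ q ^ t := Nat.pow_le_pow_right hq0 (min_le_left _ _)

theorem IsSteinerSystem.isPacking (hS : IsSteinerSystem t b n₁ S) : IsPacking t n₁ b S where
  card_points := hS.card_points
  card_block := hS.card_block
  at_most_one T hT _ hB _ hB' hTB hTB' :=
    (hS.exactly_one T hT).unique ⟨hB, hTB⟩ ⟨hB', hTB'⟩

theorem IsSteinerSystem.card_mul_choose (hS : IsSteinerSystem t b n₁ S) :
    S.card * b.choose t = n₁.choose t := by
  classical
  have h := Finset.sum_card_bipartiteAbove_eq_sum_card_bipartiteBelow (s := S)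
    (t := Finset.powersetCard t (Finset.univ : Finset X)) (fun B T => T ⊆ B)
  rw [Finset.sum_congr rfl (g := fun _ => b.choose t) ?_,
    Finset.sum_congr (s₁ := Finset.powersetCard t Finset.univ) rfl (g := fun _ => 1) ?_] at h
  · simpa [hS.card_points] using h
  · intro T hT
    obtain ⟨B, hB, hu⟩ := hS.exactly_one T (Finset.mem_powersetCard.1 hT).2
    refine Finset.card_eq_one.2 ⟨B, ?_⟩
    ext B'
    rw [Finset.mem_bipartiteBelow, Finset.mem_singleton]
    exact ⟨fun h => hu B' h, fun h => h ▸ hB⟩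
  · intro B hB
    rw [← hS.card_block B hB, ← Finset.card_powersetCard]
    congr 1
    ext T
    simp [Finset.mem_bipartiteAbove, Finset.mem_powersetCard, and_comm]

/-- Each factor of the falling factorial of `n₁` is at least `n₁ / 2`. The `+ 1` keeps the
denominator positive even if `b < t`. -/
theorem IsSteinerSystem.pow_le_card (hS : IsSteinerSystem t b n₁ S) (ht : 2 * t ≤ n₁) :
    1 / (2 ^ t * t.factorial * ((b.choose t : ℝ) + 1)) * (n₁ : ℝ) ^ t ≤ S.card := by
  have h1 := Nat.pow_le_choose (α := ℝ) t n₁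
  rw [← hS.card_mul_choose, div_le_iff₀ (by positivity)] at h1
  have h2 : (n₁ : ℝ) ≤ 2 * ((n₁ + 1 - t : ℕ) : ℝ) := by exact_mod_cast (by omega)
  have h3 : (n₁ : ℝ) ^ t ≤ 2 ^ t * ((n₁ + 1 - t : ℕ) : ℝ) ^ t := by
    rw [← mul_pow]
    exact pow_le_pow_left₀ (Nat.cast_nonneg _) h2 _
  rw [one_div_mul_eq_div, div_le_iff₀ (by positivity)]
  push_cast at h1
  calc (n₁ : ℝ) ^ t ≤ 2 ^ t * (S.card * b.choose t * t.factorial) :=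
        h3.trans (mul_le_mul_of_nonneg_left h1 (by positivity))
    _ ≤ 2 ^ t * (S.card * (b.choose t + 1) * t.factorial) := by gcongr; linarith
    _ = S.card * (2 ^ t * t.factorial * ((b.choose t : ℝ) + 1)) := by ring

theorem IsPacking.exists_isOptimalLRC {F : Type uF} [Field F] [Fintype F] [DecidableEq F]
    {r v δ τ : ℕ} (hS : IsPacking (τ + 1) n₁ (r + δ - 1) S) (hne : S.Nonempty) (hδ : 1 ≤ δ)
    (hv : 1 ≤ v) (hvr : v ≤ r) (hτ : (r - v) * τ ≤ δ ^ 2) (hq : n₁ ≤ Fintype.card F) :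
    ∃ C : Submodule F (Fin (S.card * (r + δ - 1)) → F),
      IsOptimalLRC C ((S.card - 1) * r + v) (r - v + δ) r δ := by
  classical
  obtain ⟨φ⟩ := Function.Embedding.nonempty_of_card_le (hS.card_points.le.trans hq)
  have hcard : Fintype.card (Σ B : S, B.1) = S.card * (r + δ - 1) := by
    rw [Fintype.card_sigma, Finset.sum_congr rfl (g := fun _ => r + δ - 1)]
    · simp
    · intro B _
      rw [Fintype.card_coe, hS.card_block B B.2]
  let e : Fin (S.card * (r + δ - 1)) ≃ Σ B : S, B.1 := (Fintype.equivFinOfCardEq hcard).symm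
  let blk : Fin (S.card * (r + δ - 1)) → S := fun i => (e i).1
  let pt : Fin (S.card * (r + δ - 1)) → F := fun i => φ (e i).2
  have hinj : ∀ x, Set.InjOn pt {i | blk i = x} := by
    intro x i hi j hj hij
    refine e.injective (Sigma.ext (hi.trans hj.symm) ?_)
    have h1 : ((e i).2 : X) = (e j).2 := φ.injective hij
    rw [Subtype.heq_iff_coe_eq]
    · exact h1
    · intro a
      rw [show (e i).1 = (e j).1 from hi.trans hj.symm]
  have himage : ∀ x : S, (Finset.univ.filter fun i => blk i = x).image pt = x.1.image φ := by
    intro x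
    ext z
    simp only [Finset.mem_image, Finset.mem_filter, Finset.mem_univ, true_and]
    constructor
    · rintro ⟨i, rfl, rfl⟩
      exact ⟨(e i).2, (e i).2.2, rfl⟩
    · rintro ⟨a, ha, rfl⟩
      exact ⟨e.symm ⟨x, ⟨a, ha⟩⟩, by simp [blk],
        congrArg (fun y : Σ B : S, B.1 => φ y.2) (e.apply_symm_apply _)⟩
  have : Nonempty S := hne.to_subtype
  have := isOptimalLRC_blockCode (blk := blk) (pt := pt) hδ hv hvr hτ hinj
    (fun x => by
      rw [← Finset.card_image_of_injOn (f := pt) (by simpa using hinj x), himage,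
        Finset.card_image_of_injective _ φ.injective, hS.card_block _ x.2])
    (fun x y hxy => by
      rw [himage, himage, ← Finset.image_inter _ _ φ.injective,
        Finset.card_image_of_injective _ φ.injective]
      exact Nat.le_of_lt_succ (hS.card_inter_lt x.2 y.2 fun h => hxy (Subtype.ext h)))
    (by rw [Fintype.card_coe])
  rw [Fintype.card_coe] at this
  exact ⟨_, this⟩

/-- A packing with many blocks gives a long code. -/
theorem IsPacking.pow_le_length {r δ v q : ℕ} {c₀ : ℝ} (hS : IsPacking t n₁ (r + δ - 1) S)
    (hne : S.Nonempty) (hδ : 2 ≤ δ) (hq : n₁ + r = q + v) (hc₀ : 0 < c₀)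
    (hcard : c₀ * (n₁ : ℝ) ^ t ≤ S.card) :
    c₀ / 2 ^ t * (q : ℝ) ^ t ≤ ((S.card * (r + δ - 1) : ℕ) : ℝ) := by
  have hb := hS.le_card_points hne
  -- A block fits into the point set, so `q - n₁ = r - v ≤ n₁`.
  have h1 : (q : ℝ) ≤ 2 * n₁ := by exact_mod_cast (by omega : q ≤ 2 * n₁)
  calc c₀ / 2 ^ t * (q : ℝ) ^ t ≤ c₀ / 2 ^ t * (2 * n₁) ^ t := by gcongr
    _ = c₀ * n₁ ^ t := by rw [mul_pow]; field_simp
    _ ≤ S.card := hcard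
    _ ≤ ((S.card * (r + δ - 1) : ℕ) : ℝ) := by
      exact_mod_cast Nat.le_mul_of_pos_right _ (by omega)

theorem IsPacking.length_le_pow {r δ q : ℕ} (hS : IsPacking t n₁ (r + δ - 1) S) (hq : n₁ ≤ q)
    (hq0 : 0 < q) :
    ((S.card * (r + δ - 1) : ℕ) : ℝ) ≤ ((r : ℝ) + δ) * (q : ℝ) ^ t := by
  have := Nat.mul_le_mul (hS.card_le_pow hq hq0) (show r + δ - 1 ≤ r + δ by omega)
  rw [mul_comm (q ^ t)] at this
  exact_mod_cast this

end Packing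

/-! ### Comparison with the length bound. -/

section LengthOptimal

variable {F : Type uF} [Field F] [DecidableEq F]

/-- The parameters of an optimal code with minimum distance `2 δ + 1` and `r = v + δ + 1`. -/
theorem IsOptimalLRC.eq_of_two_mul_add_one {r δ v w u v' : ℕ} (hδ : 2 ≤ δ) (hv : 1 ≤ v)
    (hr : r = v + δ + 1) (hv' : v' < r) {C : Submodule F (Fin (w * (r + δ - 1)) → F)}
    (hC : IsOptimalLRC C (u * r + v') (2 * δ + 1) r δ) : w = u + 1 ∧ v' = v := by
  have h := hC.optimal
  have hr0 : (0 : ℚ) < r := by exact_mod_cast (by omega : 0 < r)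
  have hb : ((w * (r + δ - 1) : ℕ) : ℤ) = w * (r + δ - 1) := by
    rw [Nat.cast_mul, Nat.cast_sub (by omega)]; push_cast; ring
  rw [hb] at h
  have hrz : (r : ℤ) = v + δ + 1 := by exact_mod_cast hr
  have hvz : (1 : ℤ) ≤ v := by exact_mod_cast hv
  have hδz : (2 : ℤ) ≤ δ := by exact_mod_cast hδ
  have hv'z : (v' : ℤ) < r := by exact_mod_cast hv'
  rcases Nat.eq_zero_or_pos v' with rfl | hpos
  · exfalso
    have hceil : ⌈((u * r + 0 : ℕ) : ℚ) / (r : ℚ)⌉ = (u : ℤ) := by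
      push_cast
      rw [add_zero, mul_div_cancel_right₀ _ hr0.ne']
      exact Int.ceil_natCast u
    rw [hceil] at h
    push_cast at h
    -- Impossible, since `0 < δ + 1 < v + 2 * δ`.
    have h1 : ((w : ℤ) - u) * (v + 2 * δ) = δ + 1 := by rw [hrz] at h; linarith
    rcases le_or_gt ((w : ℤ) - u) 0 with h2 | h2
    · nlinarith
    · nlinarith
  · have hceil : ⌈((u * r + v' : ℕ) : ℚ) / (r : ℚ)⌉ = (u : ℤ) + 1 := by
      have h1 : (0 : ℚ) < v' := by exact_mod_cast hpos
      have h2 : (v' : ℚ) ≤ r := by exact_mod_cast hv'.le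
      rw [Int.ceil_eq_iff, lt_div_iff₀ hr0, div_le_iff₀ hr0]
      push_cast
      constructor <;> nlinarith
    rw [hceil] at h
    push_cast at h
    -- The right side lies strictly between `0` and `2 * (v + 2 * δ)`, so the integer factor is `1`.
    have h1 : ((w : ℤ) - u) * (v + 2 * δ) = 2 * δ + v' := by rw [hrz] at h; linarith
    have h2 : (w : ℤ) - u = 1 := by
      rcases lt_trichotomy ((w : ℤ) - u) 1 with h2 | h2 | h2
      · have : (w : ℤ) - u ≤ 0 := by omega
        nlinarith
      · exact h2
      · have : 2 ≤ (w : ℤ) - u := by omega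
        nlinarith
    rw [h2] at h1
    omega

theorem lengthBound_two_mul_add_one {q r δ u v : ℕ} (hδ : 2 ≤ δ) (hr : r = v + δ + 1) :
    lengthBound q r δ (u + 1) u v (2 * δ + 1) =
      ((r : ℝ) + δ - 1) / (r * ((q : ℝ) - 1)) * (q : ℝ) ^ (δ + 1) := by
  have h2 : (2 * δ + 1 - 1) / δ = 2 := by
    rw [Nat.add_sub_cancel, Nat.mul_div_cancel _ (by omega)]
  rw [lengthBound, h2, if_neg (by decide), ← Real.rpow_natCast]
  congr 1
  · rw [Nat.cast_ofNat, mul_assoc 2 (r : ℝ), mul_div_mul_left _ _ two_ne_zero]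
  · congr 1
    subst hr
    push_cast
    ring

theorem lengthOptimalUpTo_of_pow_le [Fintype F] {r δ v n : ℕ} {c : ℝ} (hδ : 2 ≤ δ) (hv : 1 ≤ v)
    (hr : r = v + δ + 1) (hc : 0 < c) (hn : c * (Fintype.card F : ℝ) ^ δ ≤ n) :
    LengthOptimalUpTo F r δ (2 * δ + 1) n (2 * ((r : ℝ) + δ) / c) := by
  intro w u v' hv' hu C hC
  obtain ⟨rfl, rfl⟩ := hC.eq_of_two_mul_add_one hδ hv hr hv'
  have hq : 2 ≤ Fintype.card F := Fintype.one_lt_card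
  have hmain := mul_sub_one_le_of_isOptimalLRC hδ hv hr (w := u + 1) (by omega) hC.locality rfl
    hC.dim rfl fun c hc hc0 => hC.minDist.2 ⟨c, hc, hc0, rfl⟩
  rw [lengthBound_two_mul_add_one hδ hr]
  have hr1 : (1 : ℝ) ≤ r := by exact_mod_cast (by omega : 1 ≤ r)
  have hδ1 : (2 : ℝ) ≤ δ := by exact_mod_cast hδ
  have hmain' : ((u : ℝ) + 1) * r * ((Fintype.card F : ℝ) - 1) ≤ (Fintype.card F : ℝ) ^ (δ + 1) := by
    have : (((u + 1) * r * (Fintype.card F - 1) : ℕ) : ℝ) ≤ ((Fintype.card F ^ (δ + 1) : ℕ) : ℝ) :=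
      Nat.cast_le.2 hmain
    rw [Nat.cast_mul, Nat.cast_sub (by omega)] at this
    push_cast at this
    exact this
  have hq' : (2 : ℝ) ≤ Fintype.card F := by exact_mod_cast hq
  generalize (Fintype.card F : ℝ) = q at *
  have hpos : 0 < r * (q - 1) := mul_pos (by linarith) (by linarith)
  constructor
  · have hb : (((u + 1) * (r + δ - 1) : ℕ) : ℝ) = (u + 1) * (r + δ - 1) := by
      rw [Nat.cast_mul, Nat.cast_sub (by omega)]; push_cast; ring
    rw [hb, div_mul_eq_mul_div, le_div_iff₀ hpos]
    have := mul_le_mul_of_nonneg_left hmain' (show 0 ≤ (r : ℝ) + δ - 1 by linarith)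
    linarith
  · have h0 : q ^ δ ≤ n / c := by rwa [le_div_iff₀ hc, mul_comm]
    have h1 : ((r : ℝ) + δ - 1) / (r * (q - 1)) * q ≤ 2 * ((r : ℝ) + δ) := by
      rw [div_mul_eq_mul_div, div_le_iff₀ hpos]
      -- From `q ≥ 2` and `r ≥ 1`; this is the source of the factor `2` in the constant.
      have h2 : q ≤ 2 * (r * (q - 1)) := by nlinarith
      have h3 : (0 : ℝ) ≤ (r : ℝ) + δ - 1 := by linarith
      calc ((r : ℝ) + δ - 1) * q ≤ (r + δ - 1) * (2 * (r * (q - 1))) :=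
            mul_le_mul_of_nonneg_left h2 h3
        _ ≤ (r + δ) * (2 * (r * (q - 1))) :=
            mul_le_mul_of_nonneg_right (by linarith) (by linarith)
        _ = 2 * ((r : ℝ) + δ) * (r * (q - 1)) := by ring
    calc ((r : ℝ) + δ - 1) / (r * (q - 1)) * q ^ (δ + 1)
        = (((r : ℝ) + δ - 1) / (r * (q - 1)) * q) * q ^ δ := by rw [pow_succ]; ring
      _ ≤ (2 * ((r : ℝ) + δ)) * (n / c) :=
          mul_le_mul h1 h0 (by positivity) (by linarith)
      _ = 2 * ((r : ℝ) + δ) / c * n := by ring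

theorem IsPacking.lengthOptimal [Fintype F] {X : Type uX} [Fintype X] {r δ v n₁ : ℕ} {c₀ : ℝ}
    {S : Finset (Finset X)} (hS : IsPacking δ n₁ (r + δ - 1) S) (hne : S.Nonempty) (hδ : 2 ≤ δ)
    (hc₀ : 0 < c₀) (hv : 1 ≤ v) (hr : r = v + δ + 1) (hq : n₁ + r = Fintype.card F + v)
    (hcard : c₀ * (n₁ : ℝ) ^ δ ≤ S.card) :
    (∃ C : Submodule F (Fin (S.card * (r + δ - 1)) → F),
      IsOptimalLRC C ((S.card - 1) * r + v) (2 * δ + 1) r δ) ∧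
    c₀ / 2 ^ δ * (Fintype.card F : ℝ) ^ δ ≤ ((S.card * (r + δ - 1) : ℕ) : ℝ) ∧
    ((S.card * (r + δ - 1) : ℕ) : ℝ) ≤ ((r : ℝ) + δ) * (Fintype.card F : ℝ) ^ δ ∧
    LengthOptimalUpTo F r δ (2 * δ + 1) (S.card * (r + δ - 1))
      (2 * ((r : ℝ) + δ) / (c₀ / 2 ^ δ)) := by
  have hlow := hS.pow_le_length hne hδ hq hc₀ hcard
  refine ⟨?_, hlow, hS.length_le_pow (by omega) Fintype.card_pos,
    lengthOptimalUpTo_of_pow_le hδ hv hr (by positivity) hlow⟩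
  obtain ⟨τ, rfl⟩ : ∃ τ, δ = τ + 1 := ⟨δ - 1, by omega⟩
  have := hS.exists_isOptimalLRC (F := F) hne (by omega) hv (by omega)
    (by rw [hr, show v + (τ + 1) + 1 - v = τ + 2 by omega]; nlinarith) (by omega)
  rwa [show r - v + (τ + 1) = 2 * (τ + 1) + 1 by omega] at this

end LengthOptimal

theorem sub_mul_le_sq_of_le_div {r v δ τ : ℕ} (hτ : 1 ≤ τ) (hvr : v ≤ r)
    (h : (r : ℝ) - v ≤ (δ : ℝ) ^ 2 / τ) : (r - v) * τ ≤ δ ^ 2 := by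
  rw [le_div_iff₀ (by exact_mod_cast hτ), ← Nat.cast_sub hvr] at h
  exact_mod_cast h

theorem IsSteinerSystem.cast_length {X : Type uX} [Fintype X] {t n₁ r δ : ℕ}
    {S : Finset (Finset X)} (hS : IsSteinerSystem t (r + δ - 1) n₁ S) (hδ : 1 ≤ δ)
    (ht : t ≤ r + δ - 1) :
    ((S.card * (r + δ - 1) : ℕ) : ℚ) =
      (n₁.choose t : ℚ) * ((r : ℚ) + δ - 1) / ((r + δ - 1).choose t : ℚ) := by
  have hpos : ((r + δ - 1).choose t : ℚ) ≠ 0 := by exact_mod_cast (Nat.choose_pos ht).ne'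
  rw [eq_div_iff hpos, ← hS.card_mul_choose, Nat.cast_mul, Nat.cast_mul,
    Nat.cast_sub (by omega : 1 ≤ r + δ)]
  push_cast
  ring

theorem IsSteinerSystem.cast_dim {X : Type uX} [Fintype X] {t n₁ b : ℕ}
    {S : Finset (Finset X)} (hS : IsSteinerSystem t b n₁ S) (hne : S.Nonempty) (ht : t ≤ b)
    (r v : ℕ) :
    (((S.card - 1) * r + v : ℕ) : ℚ) =
      ((n₁.choose t : ℚ) / (b.choose t : ℚ) - 1) * r + v := by
  have hpos : (b.choose t : ℚ) ≠ 0 := by exact_mod_cast (Nat.choose_pos ht).ne'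
  rw [← hS.card_mul_choose, Nat.cast_mul, mul_div_cancel_right₀ _ hpos, Nat.cast_add, Nat.cast_mul,
    Nat.cast_sub hne.card_pos, Nat.cast_one]

end LRC
theorem mainTheorem10 :
    -- codes from packings, of length `O(q ^ (τ + 1))`
    (∀ r δ τ : ℕ, 2 ≤ δ → 1 ≤ τ → ∃ K : ℝ, 0 < K ∧
      ∀ (F : Type uF) [Field F] [Fintype F] [DecidableEq F] (X : Type uX) [Fintype X]
        (v n₁ : ℕ) (S : Finset (Finset X)),
        1 ≤ v → v ≤ r → (r : ℝ) - v ≤ (δ : ℝ) ^ 2 / τ → n₁ + r = Fintype.card F + v →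
        LRC.IsPacking (τ + 1) n₁ (r + δ - 1) S → S.Nonempty →
        (∃ C : Submodule F (Fin (S.card * (r + δ - 1)) → F),
          LRC.IsOptimalLRC C ((S.card - 1) * r + v) (r - v + δ) r δ) ∧
        ((S.card * (r + δ - 1) : ℕ) : ℝ) ≤ K * (Fintype.card F : ℝ) ^ (τ + 1)) ∧
    -- packings with a number of blocks of order `n₁ ^ (τ + 1)` give length of order `q ^ (τ + 1)`
    (∀ (r δ τ : ℕ) (c₀ : ℝ), 2 ≤ δ → 1 ≤ τ → 0 < c₀ → ∃ c : ℝ, 0 < c ∧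
      ∀ (F : Type uF) [Field F] [Fintype F] [DecidableEq F] (X : Type uX) [Fintype X]
        (v n₁ : ℕ) (S : Finset (Finset X)),
        1 ≤ v → v ≤ r → (r : ℝ) - v ≤ (δ : ℝ) ^ 2 / τ → n₁ + r = Fintype.card F + v →
        LRC.IsPacking (τ + 1) n₁ (r + δ - 1) S → S.Nonempty →
        c₀ * (n₁ : ℝ) ^ (τ + 1) ≤ S.card →
        c * (Fintype.card F : ℝ) ^ (τ + 1) ≤ ((S.card * (r + δ - 1) : ℕ) : ℝ)) ∧
    -- asymptotically optimal length from packings, `r - v = δ + 1`, `τ = δ - 1`, `d = 2 δ + 1`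
    (∀ (r δ : ℕ) (c₀ : ℝ), 2 ≤ δ → 0 < c₀ → ∃ c₁ c₂ K : ℝ, 0 < c₁ ∧ 0 < c₂ ∧ 0 < K ∧
      ∀ (F : Type uF) [Field F] [Fintype F] [DecidableEq F] (X : Type uX) [Fintype X]
        (v n₁ : ℕ) (S : Finset (Finset X)),
        1 ≤ v → r = v + δ + 1 → n₁ + r = Fintype.card F + v →
        LRC.IsPacking δ n₁ (r + δ - 1) S → c₀ * (n₁ : ℝ) ^ δ ≤ S.card →
        2 * (r - v + 1) ≤ S.card - 1 →
        (∃ C : Submodule F (Fin (S.card * (r + δ - 1)) → F),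
          LRC.IsOptimalLRC C ((S.card - 1) * r + v) (2 * δ + 1) r δ) ∧
        c₁ * (Fintype.card F : ℝ) ^ δ ≤ ((S.card * (r + δ - 1) : ℕ) : ℝ) ∧
        ((S.card * (r + δ - 1) : ℕ) : ℝ) ≤ c₂ * (Fintype.card F : ℝ) ^ δ ∧
        LRC.LengthOptimalUpTo F r δ (2 * δ + 1) (S.card * (r + δ - 1)) K) ∧
    -- codes from Steiner systems
    (∀ r δ τ : ℕ, 2 ≤ δ → 1 ≤ τ → τ + 1 ≤ r + δ - 1 →
      ∀ (F : Type uF) [Field F] [Fintype F] [DecidableEq F] (X : Type uX) [Fintype X]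
        (v n₁ : ℕ) (S : Finset (Finset X)),
        1 ≤ v → v ≤ r → (r : ℝ) - v ≤ (δ : ℝ) ^ 2 / τ → n₁ + r = Fintype.card F + v →
        LRC.IsSteinerSystem (τ + 1) (r + δ - 1) n₁ S → S.Nonempty →
        ∃ n k : ℕ,
          (n : ℚ) = (n₁.choose (τ + 1) : ℚ) * ((r : ℚ) + δ - 1) /
            ((r + δ - 1).choose (τ + 1) : ℚ) ∧
          (k : ℚ) = ((n₁.choose (τ + 1) : ℚ) / ((r + δ - 1).choose (τ + 1) : ℚ) - 1) * r + v ∧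
          ∃ C : Submodule F (Fin n → F), LRC.IsOptimalLRC C k (r - v + δ) r δ) ∧
    -- asymptotically optimal length from Steiner systems
    (∀ r δ : ℕ, 2 ≤ δ → ∃ c₁ c₂ K : ℝ, 0 < c₁ ∧ 0 < c₂ ∧ 0 < K ∧
      ∀ (F : Type uF) [Field F] [Fintype F] [DecidableEq F] (X : Type uX) [Fintype X]
        (v n₁ : ℕ) (S : Finset (Finset X)),
        1 ≤ v → r = v + δ + 1 → n₁ + r = Fintype.card F + v →
        LRC.IsSteinerSystem δ (r + δ - 1) n₁ S → 2 * (r - v + 1) ≤ S.card - 1 →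
        ∃ n k : ℕ,
          (n : ℚ) = (n₁.choose δ : ℚ) * ((r : ℚ) + δ - 1) / ((r + δ - 1).choose δ : ℚ) ∧
          (k : ℚ) = ((n₁.choose δ : ℚ) / ((r + δ - 1).choose δ : ℚ) - 1) * r + v ∧
          (∃ C : Submodule F (Fin n → F), LRC.IsOptimalLRC C k (2 * δ + 1) r δ) ∧
          c₁ * (Fintype.card F : ℝ) ^ δ ≤ (n : ℝ) ∧
          (n : ℝ) ≤ c₂ * (Fintype.card F : ℝ) ^ δ ∧
          LRC.LengthOptimalUpTo F r δ (2 * δ + 1) n K) := by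

  refine ⟨fun r δ τ hδ hτ => ⟨(r : ℝ) + δ, by positivity, ?_⟩,
    fun r δ τ c₀ hδ hτ hc₀ => ⟨c₀ / 2 ^ (τ + 1), by positivity, ?_⟩,
    fun r δ c₀ hδ hc₀ => ⟨c₀ / 2 ^ δ, (r : ℝ) + δ, 2 * ((r : ℝ) + δ) / (c₀ / 2 ^ δ),
      by positivity, by positivity, by positivity, ?_⟩, ?_, ?_⟩
  · intro F _ _ _ X _ v n₁ S hv hvr hle hq hS hne
    exact ⟨hS.exists_isOptimalLRC hne (by omega) hv hvr (LRC.sub_mul_le_sq_of_le_div hτ hvr hle)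
      (by omega), hS.length_le_pow (by omega) Fintype.card_pos⟩
  · intro F _ _ _ X _ v n₁ S hv hvr hle hq hS hne hcard
    exact hS.pow_le_length hne hδ hq hc₀ hcard
  · intro F _ _ _ X _ v n₁ S hv hr hq hS hcard hw
    exact hS.lengthOptimal (Finset.card_pos.1 (by omega)) hδ hc₀ hv hr hq hcard
  · intro r δ τ hδ hτ hτb F _ _ _ X _ v n₁ S hv hvr hle hq hS hne
    exact ⟨_, _, hS.cast_length (by omega) hτb, hS.cast_dim hne hτb r v,
      hS.isPacking.exists_isOptimalLRC hne (by omega) hv hvr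
        (LRC.sub_mul_le_sq_of_le_div hτ hvr hle) (by omega)⟩
  · intro r δ hδ
    -- The density from `IsSteinerSystem.pow_le_card`; its condition `2 * δ ≤ n₁` holds because a
    -- block has `v + 2 * δ` points.
    let c₀ : ℝ := 1 / (2 ^ δ * δ.factorial * (((r + δ - 1).choose δ : ℝ) + 1))
    have hc₀ : 0 < c₀ := by positivity
    refine ⟨c₀ / 2 ^ δ, (r : ℝ) + δ, 2 * ((r : ℝ) + δ) / (c₀ / 2 ^ δ),
      by positivity, by positivity, by positivity, ?_⟩
    intro F _ _ _ X _ v n₁ S hv hr hq hS hw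
    have hne : S.Nonempty := Finset.card_pos.1 (by omega)
    have hb := hS.isPacking.le_card_points hne
    exact ⟨_, _, hS.cast_length (by omega) (by omega), hS.cast_dim hne (by omega) r v,
      hS.isPacking.lengthOptimal hne hδ hc₀ hv hr hq (hS.pow_le_card (by omega))⟩
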